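/- Let $K$ be a connected and simply connected compact Lie group with Lie algebra $\mathfrak k$, and let $\langle\cdot,\cdot\rangle$ be the Killing form of $\mathfrak k$ (which is nondegenerate). Let $Z\mapsto -Z^*$ denote the conjugation of $\mathfrak k^{\mathbb C}=\mathbb C\otimes_{\mathbb R}\mathfrak k$ with fixed point set $\mathfrak k$. Fix a $\mathfrak k$-compatible triangular decomposition $\mathfrak k^{\mathbb C}=\mathfrak n_-+\mathfrak h+\mathfrak n_+$; that is, $\mathfrak h$ is a Cartan subalgebra, $\mathfrak n_+$ (resp. $\mathfrak n_-$) is the sum of the root spaces for a chosen system of positive roots (resp. for the negative roots), and $-(\mathfrak n_\pm)^*=\mathfrak n_\mp$. Define $\mathcal H\colon\mathfrak k^{\mathbb C}\to\mathfrak k^{\mathbb C}$ by $\mathcal H(Z_-+Z_{\mathfrak h}+Z_+)=-iZ_-+iZ_+$. It preserves $\mathfrak k$; write $\mathcal H_{\mathfrak k}\colon\mathfrak k\to\mathfrak k$ for its restriction, which is skew-symmetric for $\langle\cdot,\cdot\rangle$. Use the Killing form to identify $\mathfrak k^*$ with $\mathfrak k$ and regard $\mathcal H_{\mathfrak k}$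 as the element of $\mathfrak k\wedge\mathfrak k$ whose value on the covectors $\langle P,\cdot\rangle$, $\langle Q,\cdot\rangle$ is $\langle\mathcal H_{\mathfrak k}P,Q\rangle$. Let $\pi_K$ be the bivector field of the standard (Lu–Weinstein) Poisson Lie group structure on $K$, defined by $$\pi_K|_k=(\ell_k)_*\mathcal H_{\mathfrak k}-(r_k)_*\mathcal H_{\mathfrak k}\qquad(k\in K),$$ where $\ell_k$ and $r_k$ are left and right translation by $k$. For $k\in K$ and $P\in\mathfrak k$ let $(k,P)$ denote the cotangent vector $v\mapsto\langle P,(r_{k^{-1}})_*v\rangle$ of $K$ at $k$, i.e. identify $T^*K\cong K\times\mathfrak k$ by right translation and the Killing form. Then for all $k\in K$ and $P,Q\in\mathfrak k$, $$\pi_K\big((k,P),(k,Q)\big)=\big\langle(\mathrm{Ad}(k)\circ\mathcal H_{\mathfrak k}\circ\mathrm{Ad}(k^{-1})-\mathcal H_{\mathfrak k})(P),\,Q\big\rangle .$$ -/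

import Mathlib

open scoped TensorProduct Manifold

noncomputable section

namespace LuWeinstein

/-! ### Triangular decompositions of a complex Lie algebra -/

/-- `α` is a root of the Cartan subalgebra `h` acting on `g` by the adjoint action: `α ≠ 0` and the
root space of `α` is nonzero. -/
def IsRoot {g : Type*} [LieRing g] [LieAlgebra ℂ g] (h : LieSubalgebra ℂ g) [h.IsCartanSubalgebra]
    (α : h → ℂ) : Prop :=
  α ≠ 0 ∧ LieAlgebra.rootSpace h α ≠ ⊥

/-- The data of a triangular decomposition `g = n₋ + h + n₊`: a Cartan subalgebra `h` and a system
of positive roots (exactly one of `α`, `-α` is positive for each root `α`, and a root which is a sum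
of two positive roots is positive). -/
structure TriangularDecomposition (g : Type*) [LieRing g] [LieAlgebra ℂ g] where
  cartan : LieSubalgebra ℂ g
  [isCartan : cartan.IsCartanSubalgebra]
  pos : Set (cartan → ℂ)
  isRoot_of_pos : ∀ α ∈ pos, IsRoot cartan α
  pos_iff : ∀ α, IsRoot cartan α → (α ∈ pos ↔ -α ∉ pos)
  add_pos : ∀ α ∈ pos, ∀ β ∈ pos, IsRoot cartan (α + β) → α + β ∈ pos

attribute [instance] TriangularDecomposition.isCartan

namespace TriangularDecomposition

variable {g : Type*} [LieRing g] [LieAlgebra ℂ g] (T : TriangularDecomposition g)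

/-- The sum of the root spaces (or of `h`, for the index `0`) with index in `S`. -/
def sumOver (S : Set (T.cartan → ℂ)) : Submodule ℂ g :=
  ⨆ α ∈ S, (LieAlgebra.rootSpace T.cartan α).toSubmodule

/-- `n₊`, the sum of the positive root spaces. -/
def nPlus : Submodule ℂ g :=
  ⨆ α ∈ T.pos, (LieAlgebra.rootSpace T.cartan α).toSubmodule

/-- `n₋`, the sum of the negative root spaces. -/
def nMinus : Submodule ℂ g :=
  ⨆ α ∈ T.pos, (LieAlgebra.rootSpace T.cartan (-α)).toSubmodule

theorem nPlus_eq : T.nPlus = T.sumOver T.pos := rfl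

theorem nMinus_eq : T.nMinus = T.sumOver {α | -α ∈ T.pos} := by
  apply le_antisymm
  · refine iSup₂_le fun α hα => ?_
    exact le_iSup₂_of_le (f := fun β (_ : β ∈ {β | -β ∈ T.pos}) =>
      (LieAlgebra.rootSpace T.cartan β).toSubmodule) (-α) (by simpa using hα) le_rfl
  · refine iSup₂_le fun α hα => ?_
    refine le_iSup₂_of_le (f := fun β (_ : β ∈ T.pos) =>
      (LieAlgebra.rootSpace T.cartan (-β)).toSubmodule) (-α) hα ?_
    rw [neg_neg]

theorem cartan_eq [FiniteDimensional ℂ g] : T.cartan.toSubmodule = T.sumOver {0} := by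
  have := LieAlgebra.rootSpace_zero_eq ℂ g T.cartan
  simp [sumOver, this]

theorem sumOver_union (S S' : Set (T.cartan → ℂ)) :
    T.sumOver (S ∪ S') = T.sumOver S ⊔ T.sumOver S' := iSup_union

theorem zero_notMem_pos : (0 : T.cartan → ℂ) ∉ T.pos := fun h => (T.isRoot_of_pos 0 h).1 rfl

theorem neg_notMem_pos {α : T.cartan → ℂ} (h : α ∈ T.pos) : -α ∉ T.pos :=
  (T.pos_iff α (T.isRoot_of_pos α h)).1 h

theorem sumOver_disjoint {S S' : Set (T.cartan → ℂ)} (h : Disjoint S S') :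
    Disjoint (T.sumOver S) (T.sumOver S') :=
  iSupIndep.disjoint_biSup_biSup (LieSubmodule.iSupIndep_toSubmodule.mpr <|
    LieModule.iSupIndep_genWeightSpace ℂ T.cartan g) h

theorem sumOver_eq_top [FiniteDimensional ℂ g] {S : Set (T.cartan → ℂ)} (h0 : 0 ∈ S)
    (h : ∀ α, IsRoot T.cartan α → α ∈ S) : T.sumOver S = ⊤ := by
  have htop := (LieSubmodule.iSup_toSubmodule_eq_top.mpr <|
    LieModule.iSup_genWeightSpace_eq_top ℂ T.cartan g)
  rw [eq_top_iff, ← htop]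
  refine iSup_le fun α => ?_
  by_cases hα : α ∈ S
  · exact le_iSup₂_of_le (f := fun β (_ : β ∈ S) =>
      (LieAlgebra.rootSpace T.cartan β).toSubmodule) α hα le_rfl
  · have h1 : α ≠ 0 := fun h => hα (h ▸ h0)
    have h2 : LieAlgebra.rootSpace T.cartan α = ⊥ := by
      by_contra h3
      exact hα (h α ⟨h1, h3⟩)
    have h3 : (LieModule.genWeightSpace g α : LieSubmodule ℂ T.cartan g) = ⊥ := h2
    rw [h3]
    simp

theorem isCompl_nPlus [FiniteDimensional ℂ g] :
    IsCompl T.nPlus (T.cartan.toSubmodule ⊔ T.nMinus) := by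
  rw [T.cartan_eq, T.nMinus_eq, T.nPlus_eq, ← sumOver_union]
  refine ⟨T.sumOver_disjoint ?_, ?_⟩
  · rw [Set.disjoint_left]
    rintro α hα (h | h)
    · exact T.zero_notMem_pos (h ▸ hα)
    · exact T.neg_notMem_pos hα h
  · rw [codisjoint_iff, ← sumOver_union]
    refine T.sumOver_eq_top (by simp) fun α hα => ?_
    by_cases h : α ∈ T.pos
    · exact Or.inl h
    · exact Or.inr (Or.inr (not_not.1 fun h' => h ((T.pos_iff α hα).2 h')))

theorem isCompl_nMinus [FiniteDimensional ℂ g] :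
    IsCompl T.nMinus (T.cartan.toSubmodule ⊔ T.nPlus) := by
  rw [T.cartan_eq, T.nMinus_eq, T.nPlus_eq, ← sumOver_union]
  refine ⟨T.sumOver_disjoint ?_, ?_⟩
  · rw [Set.disjoint_left]
    rintro α hα (h | h)
    · rw [Set.mem_singleton_iff.1 h] at hα
      exact T.zero_notMem_pos (by simpa using hα)
    · exact T.neg_notMem_pos h hα
  · rw [codisjoint_iff, ← sumOver_union]
    refine T.sumOver_eq_top (by simp) fun α hα => ?_
    by_cases h : α ∈ T.pos
    · exact Or.inr (Or.inr h)
    · exact Or.inl (not_not.1 fun h' => h ((T.pos_iff α hα).2 h'))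

/-- The `ℂ`-linear map `𝓗(Z₋ + Z_h + Z₊) = -i Z₋ + i Z₊`. -/
def hilbert [FiniteDimensional ℂ g] : g →ₗ[ℂ] g :=
  Complex.I • T.nPlus.projection _ T.isCompl_nPlus -
    Complex.I • T.nMinus.projection _ T.isCompl_nMinus

theorem hilbert_apply [FiniteDimensional ℂ g] {X Y Z : g} (hX : X ∈ T.nMinus) (hY : Y ∈ T.cartan)
    (hZ : Z ∈ T.nPlus) : T.hilbert (X + Y + Z) = -(Complex.I • X) + Complex.I • Z := by
  have h1 : X ∈ T.cartan.toSubmodule ⊔ T.nMinus := Submodule.mem_sup_right hX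
  have h2 : Y ∈ T.cartan.toSubmodule ⊔ T.nMinus := Submodule.mem_sup_left hY
  have h3 : Z ∈ T.cartan.toSubmodule ⊔ T.nPlus := Submodule.mem_sup_right hZ
  have h4 : Y ∈ T.cartan.toSubmodule ⊔ T.nPlus := Submodule.mem_sup_left hY
  simp only [hilbert, LinearMap.sub_apply, LinearMap.smul_apply, map_add,
    Submodule.projection_apply_of_mem_left _ hX, Submodule.projection_apply_of_mem_left _ hZ,
    Submodule.projection_apply_of_mem_right _ h1, Submodule.projection_apply_of_mem_right _ h2,
    Submodule.projection_apply_of_mem_right _ h3, Submodule.projection_apply_of_mem_right _ h4,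
    smul_zero]
  module

theorem exists_decomp [FiniteDimensional ℂ g] (W : g) :
    ∃ X ∈ T.nMinus, ∃ Y ∈ T.cartan, ∃ Z ∈ T.nPlus, W = X + Y + Z := by
  have h : W ∈ T.nPlus ⊔ (T.cartan.toSubmodule ⊔ T.nMinus) := by
    rw [T.isCompl_nPlus.sup_eq_top]; trivial
  obtain ⟨Z, hZ, V, hV, rfl⟩ := Submodule.mem_sup.1 h
  obtain ⟨Y, hY, X, hX, rfl⟩ := Submodule.mem_sup.1 hV
  exact ⟨X, hX, Y, hY, Z, hZ, by abel⟩

theorem killing_sumOver [FiniteDimensional ℂ g] {S S' : Set (T.cartan → ℂ)}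
    (h : ∀ α ∈ S, ∀ β ∈ S', α + β ≠ 0) {X Y : g} (hX : X ∈ T.sumOver S) (hY : Y ∈ T.sumOver S') :
    killingForm ℂ g X Y = 0 := by
  have h1 : T.sumOver S' ≤ LinearMap.ker (killingForm ℂ g X) := by
    refine iSup₂_le fun β hβ y hy => ?_
    rw [LinearMap.mem_ker]
    have h2 : T.sumOver S ≤ LinearMap.ker ((killingForm ℂ g).flip y) := by
      refine iSup₂_le fun α hα x hx => ?_
      rw [LinearMap.mem_ker]
      exact LieAlgebra.killingForm_apply_eq_zero_of_mem_rootSpace_of_add_ne_zero ℂ g T.cartan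
        hx hy (h α hα β hβ)
    simpa using h2 hX
  simpa using h1 hY

theorem killing_nPlus_nPlus [FiniteDimensional ℂ g] {X Y : g} (hX : X ∈ T.nPlus)
    (hY : Y ∈ T.nPlus) : killingForm ℂ g X Y = 0 := by
  refine T.killing_sumOver (fun α hα β hβ h => T.neg_notMem_pos hα ?_) hX hY
  rwa [neg_eq_of_add_eq_zero_right h]

theorem killing_nMinus_nMinus [FiniteDimensional ℂ g] {X Y : g} (hX : X ∈ T.nMinus)
    (hY : Y ∈ T.nMinus) : killingForm ℂ g X Y = 0 := by
  rw [nMinus_eq] at hX hY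
  refine T.killing_sumOver (S := {α | -α ∈ T.pos}) (fun α hα β hβ h => ?_) hX hY
  refine T.neg_notMem_pos (α := -α) hα ?_
  rw [neg_eq_of_add_eq_zero_right h]
  exact hβ

theorem killing_cartan_nPlus [FiniteDimensional ℂ g] {X Y : g} (hX : X ∈ T.cartan)
    (hY : Y ∈ T.nPlus) : killingForm ℂ g X Y = 0 := by
  have hX' : X ∈ T.sumOver {0} := T.cartan_eq ▸ hX
  refine T.killing_sumOver (fun α hα β hβ h => ?_) hX' hY
  rw [Set.mem_singleton_iff.1 hα, zero_add] at h
  exact T.zero_notMem_pos (h ▸ hβ)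

theorem killing_cartan_nMinus [FiniteDimensional ℂ g] {X Y : g} (hX : X ∈ T.cartan)
    (hY : Y ∈ T.nMinus) : killingForm ℂ g X Y = 0 := by
  have hX' : X ∈ T.sumOver {0} := T.cartan_eq ▸ hX
  rw [nMinus_eq] at hY
  refine T.killing_sumOver (fun α hα β hβ h => ?_) hX' hY
  rw [Set.mem_singleton_iff.1 hα, zero_add] at h
  rw [h] at hβ
  exact T.zero_notMem_pos (by simpa using hβ)

/-- `𝓗` is skew-symmetric for the Killing form. -/
theorem hilbert_skew [FiniteDimensional ℂ g] (V W : g) :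
    killingForm ℂ g (T.hilbert V) W = -killingForm ℂ g V (T.hilbert W) := by
  obtain ⟨X, hX, Y, hY, Z, hZ, rfl⟩ := T.exists_decomp V
  obtain ⟨X', hX', Y', hY', Z', hZ', rfl⟩ := T.exists_decomp W
  have c := LieModule.traceForm_comm ℂ g g
  have e1 := T.killing_nPlus_nPlus hZ hZ'
  have e2 := T.killing_nMinus_nMinus hX hX'
  have e3 := T.killing_cartan_nPlus hY hZ'
  have e4 := T.killing_cartan_nMinus hY hX'
  have e5 := (c Z Y').trans (T.killing_cartan_nPlus hY' hZ)
  have e6 := (c X Y').trans (T.killing_cartan_nMinus hY' hX)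
  rw [T.hilbert_apply hX hY hZ, T.hilbert_apply hX' hY' hZ']
  simp only [map_add, map_neg, map_smul, LinearMap.add_apply, LinearMap.neg_apply,
    LinearMap.smul_apply, smul_eq_mul, e1, e2, e3, e4, e5, e6]
  ring

end TriangularDecomposition

/-! ### Compatibility with a real form -/

section RealForm

variable (L : Type*) [LieRing L] [LieAlgebra ℝ L]

/-- The conjugation `Z ↦ -Z^*` of `ℂ ⊗ L` with fixed point set `L`, i.e. the Cartan involution
selecting `L` in its complexification when `L` is a compact semisimple Lie algebra. -/
def conj : (ℂ ⊗[ℝ] L) →ₗ[ℝ] (ℂ ⊗[ℝ] L) :=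
  Complex.conjAe.toLinearMap.rTensor L

/-- The inclusion `L → ℂ ⊗ L`, `P ↦ 1 ⊗ P`. -/
def incl : L →ₗ[ℝ] (ℂ ⊗[ℝ] L) := TensorProduct.mk ℝ ℂ L 1

/-- The projection of `ℂ ⊗ L = L + iL` to `L`. -/
def rePart : (ℂ ⊗[ℝ] L) →ₗ[ℝ] L :=
  (TensorProduct.lid ℝ L).toLinearMap ∘ₗ Complex.reLm.rTensor L

@[simp] theorem conj_tmul (z : ℂ) (P : L) :
    conj L (z ⊗ₜ[ℝ] P) = (starRingEnd ℂ z) ⊗ₜ[ℝ] P := rfl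

@[simp] theorem rePart_tmul (z : ℂ) (P : L) : rePart L (z ⊗ₜ[ℝ] P) = z.re • P := by
  simp [rePart]

theorem incl_apply (P : L) : incl L P = 1 ⊗ₜ[ℝ] P := rfl

@[simp] theorem rePart_incl (P : L) : rePart L (incl L P) = P := by simp [incl_apply]

theorem incl_rePart (Z : ℂ ⊗[ℝ] L) : incl L (rePart L Z) = (2⁻¹ : ℝ) • (Z + conj L Z) := by
  induction Z using TensorProduct.induction_on with
  | zero => simp
  | tmul z P =>
    rw [rePart_tmul, incl_apply, conj_tmul, ← TensorProduct.add_tmul, TensorProduct.smul_tmul',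
      TensorProduct.tmul_smul, TensorProduct.smul_tmul']
    congr 1
    apply Complex.ext <;> simp
    ring
  | add X Y hX hY => rw [map_add, map_add, hX, hY, map_add, ← smul_add]; congr 1; abel

theorem conj_conj (Z : ℂ ⊗[ℝ] L) : conj L (conj L Z) = Z := by
  induction Z using TensorProduct.induction_on with
  | zero => simp
  | tmul z P => simp
  | add X Y hX hY => rw [map_add, map_add, hX, hY]

theorem conj_smul (c : ℂ) (Z : ℂ ⊗[ℝ] L) :
    conj L (c • Z) = (starRingEnd ℂ c) • conj L Z := by
  induction Z using TensorProduct.induction_on with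
  | zero => simp
  | tmul z P => simp [TensorProduct.smul_tmul']
  | add X Y hX hY => rw [smul_add, map_add, map_add, hX, hY, smul_add]

theorem conj_eq_self_iff (Z : ℂ ⊗[ℝ] L) : conj L Z = Z ↔ ∃ P : L, Z = 1 ⊗ₜ[ℝ] P := by
  constructor
  · intro h
    refine ⟨rePart L Z, ?_⟩
    rw [← incl_apply, incl_rePart, h, ← two_smul ℝ Z, smul_smul]
    norm_num
  · rintro ⟨P, rfl⟩
    simp

variable {L}

/-- The triangular decomposition `ℂ ⊗ L = n₋ + h + n₊` is compatible with the real form `L`: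
`-(n₊)^* = n₋` and `-(n₋)^* = n₊`. -/
def TriangularDecomposition.IsCompatible (T : TriangularDecomposition (ℂ ⊗[ℝ] L)) : Prop :=
  conj L '' (T.nPlus : Set (ℂ ⊗[ℝ] L)) = (T.nMinus : Set (ℂ ⊗[ℝ] L)) ∧
    conj L '' (T.nMinus : Set (ℂ ⊗[ℝ] L)) = (T.nPlus : Set (ℂ ⊗[ℝ] L))

theorem TriangularDecomposition.IsCompatible.conj_mem_nMinus
    {T : TriangularDecomposition (ℂ ⊗[ℝ] L)} (hT : T.IsCompatible) {Z : ℂ ⊗[ℝ] L}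
    (hZ : Z ∈ T.nPlus) : conj L Z ∈ T.nMinus := by
  rw [← SetLike.mem_coe, ← hT.1]
  exact ⟨Z, hZ, rfl⟩

theorem TriangularDecomposition.IsCompatible.conj_mem_nPlus
    {T : TriangularDecomposition (ℂ ⊗[ℝ] L)} (hT : T.IsCompatible) {Z : ℂ ⊗[ℝ] L}
    (hZ : Z ∈ T.nMinus) : conj L Z ∈ T.nPlus := by
  rw [← SetLike.mem_coe, ← hT.2]
  exact ⟨Z, hZ, rfl⟩

variable [FiniteDimensional ℝ L]

/-- The `ℝ`-linear transformation `𝓗_L : L → L` whose complexification is `𝓗`. When `L` has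
nondegenerate Killing form (as is the case for the Lie algebra of a simply connected compact Lie
group) and the decomposition is compatible with `L`, `𝓗` maps `L` to itself and taking the real part
is superfluous, see `incl_hilbertReal`. -/
def TriangularDecomposition.hilbertReal (T : TriangularDecomposition (ℂ ⊗[ℝ] L)) : L →ₗ[ℝ] L :=
  rePart L ∘ₗ T.hilbert.restrictScalars ℝ ∘ₗ incl L

theorem killingForm_incl (P : L) (Z : ℂ ⊗[ℝ] L) :
    (killingForm ℂ (ℂ ⊗[ℝ] L) Z (incl L P)).re = killingForm ℝ L (rePart L Z) P := by
  rw [killingForm, LieModule.traceForm_baseChange]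
  induction Z using TensorProduct.induction_on with
  | zero => simp
  | tmul z Q =>
    simp [incl_apply]
    exact mul_comm _ _
  | add X Y hX hY => rw [map_add, LinearMap.add_apply, Complex.add_re, hX, hY, map_add, map_add,
      LinearMap.add_apply]

theorem killingForm_conj (Z W : ℂ ⊗[ℝ] L) :
    killingForm ℂ (ℂ ⊗[ℝ] L) (conj L Z) (conj L W) =
      starRingEnd ℂ (killingForm ℂ (ℂ ⊗[ℝ] L) Z W) := by
  rw [killingForm, LieModule.traceForm_baseChange]
  induction Z using TensorProduct.induction_on with
  | zero => simp
  | tmul z Q =>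
    induction W using TensorProduct.induction_on with
    | zero => simp
    | tmul w R => simp
    | add X Y hX hY => rw [map_add, map_add, hX, hY, map_add, map_add]
  | add X Y hX hY => rw [map_add, map_add, LinearMap.add_apply, hX, hY, map_add,
      LinearMap.add_apply, map_add]

/-- `𝓗_L` is skew-symmetric for the Killing form of `L`. -/
theorem TriangularDecomposition.hilbertReal_skew (T : TriangularDecomposition (ℂ ⊗[ℝ] L))
    (P Q : L) :
    killingForm ℝ L (T.hilbertReal P) Q = -killingForm ℝ L P (T.hilbertReal Q) := by
  have c := LieModule.traceForm_comm ℝ L L P (T.hilbertReal Q)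
  have c' := LieModule.traceForm_comm ℂ (ℂ ⊗[ℝ] L) (ℂ ⊗[ℝ] L) (T.hilbert (incl L Q)) (incl L P)
  rw [c]
  have e1 := killingForm_incl Q (T.hilbert (incl L P))
  have e2 := killingForm_incl P (T.hilbert (incl L Q))
  have e3 : T.hilbertReal P = rePart L (T.hilbert (incl L P)) := rfl
  have e4 : T.hilbertReal Q = rePart L (T.hilbert (incl L Q)) := rfl
  rw [e3, e4, ← e1, ← e2, T.hilbert_skew, c', Complex.neg_re]

/-- If the Killing form of `L` is nondegenerate, `h` is stable under conjugation, being the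
Killing-orthogonal complement of `n₋ + n₊`. -/
theorem TriangularDecomposition.IsCompatible.conj_mem_cartan [LieAlgebra.IsKilling ℝ L]
    {T : TriangularDecomposition (ℂ ⊗[ℝ] L)} (hT : T.IsCompatible) {Y : ℂ ⊗[ℝ] L}
    (hY : Y ∈ T.cartan) : conj L Y ∈ T.cartan := by
  have hp : ∀ W ∈ T.nPlus, killingForm ℂ (ℂ ⊗[ℝ] L) (conj L Y) W = 0 := by
    intro W hW
    rw [← conj_conj L W, killingForm_conj,
      T.killing_cartan_nMinus hY (hT.conj_mem_nMinus hW), map_zero]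
  have hm : ∀ W ∈ T.nMinus, killingForm ℂ (ℂ ⊗[ℝ] L) (conj L Y) W = 0 := by
    intro W hW
    rw [← conj_conj L W, killingForm_conj,
      T.killing_cartan_nPlus hY (hT.conj_mem_nPlus hW), map_zero]
  have hnd : ∀ V : ℂ ⊗[ℝ] L, (∀ W, killingForm ℂ (ℂ ⊗[ℝ] L) V W = 0) → V = 0 := by
    intro V hV
    have key : ∀ V : ℂ ⊗[ℝ] L, (∀ W, killingForm ℂ (ℂ ⊗[ℝ] L) V W = 0) → rePart L V = 0 := by
      intro V hV
      have : rePart L V ∈ LinearMap.ker (killingForm ℝ L) := by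
        rw [LinearMap.mem_ker]
        ext P
        rw [← killingForm_incl, hV]; rfl
      simpa using this
    have h1 := key V hV
    have h2 := key (Complex.I • V) (fun W => by rw [map_smul, LinearMap.smul_apply, hV W, smul_zero])
    have h3 : incl L (rePart L V) = 0 := by rw [h1, map_zero]
    have h4 : incl L (rePart L (Complex.I • V)) = 0 := by rw [h2, map_zero]
    rw [incl_rePart] at h3 h4
    rw [conj_smul, Complex.conj_I, neg_smul, ← sub_eq_add_neg, ← smul_sub] at h4
    have h5 : V + conj L V = 0 := (smul_eq_zero.1 h3).resolve_left (by norm_num)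
    have h6 : V - conj L V = 0 :=
      (smul_eq_zero.1 ((smul_eq_zero.1 h4).resolve_left (by norm_num))).resolve_left
        Complex.I_ne_zero
    have h7 : (2 : ℝ) • V = 0 := by
      rw [two_smul]
      calc V + V = (V + conj L V) + (V - conj L V) := by abel
        _ = 0 := by rw [h5, h6, add_zero]
    exact (smul_eq_zero.1 h7).resolve_left (by norm_num)
  obtain ⟨A, hA, B, hB, C, hC, e⟩ := T.exists_decomp (conj L Y)
  have c := LieModule.traceForm_comm ℂ (ℂ ⊗[ℝ] L) (ℂ ⊗[ℝ] L)
  have hAC : A + C = 0 := by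
    apply hnd
    intro W
    obtain ⟨X', hX', Y', hY', Z', hZ', rfl⟩ := T.exists_decomp W
    have e1 := hp Z' hZ'
    have e2 := hm X' hX'
    rw [e] at e1 e2
    have e3 := T.killing_cartan_nPlus hB hZ'
    have e4 := T.killing_cartan_nMinus hB hX'
    have e5 := (c C Y').trans (T.killing_cartan_nPlus hY' hC)
    have e6 := (c A Y').trans (T.killing_cartan_nMinus hY' hA)
    simp only [map_add, LinearMap.add_apply, e3, e4, e5, e6] at e1 e2 ⊢
    linear_combination e1 + e2
  rw [e, show A + B + C = B + (A + C) by abel, hAC, add_zero]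
  exact hB

/-- If the Killing form of `L` is nondegenerate and the decomposition is compatible with `L`, then
`L` is stable under `𝓗`, and `𝓗_L` is the restriction of `𝓗` to `L`. -/
theorem TriangularDecomposition.IsCompatible.incl_hilbertReal [LieAlgebra.IsKilling ℝ L]
    {T : TriangularDecomposition (ℂ ⊗[ℝ] L)} (hT : T.IsCompatible) (P : L) :
    (1 : ℂ) ⊗ₜ[ℝ] T.hilbertReal P = T.hilbert ((1 : ℂ) ⊗ₜ[ℝ] P) := by
  have h : conj L (T.hilbert (incl L P)) = T.hilbert (incl L P) := by
    have hP : conj L (incl L P) = incl L P := by simp [incl_apply]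
    conv_rhs => rw [← hP]
    obtain ⟨X, hX, Y, hY, Z, hZ, e⟩ := T.exists_decomp (incl L P)
    have hX' : conj L X ∈ T.nPlus := hT.conj_mem_nPlus hX
    have hZ' : conj L Z ∈ T.nMinus := hT.conj_mem_nMinus hZ
    have e' : conj L (X + Y + Z) = conj L Z + conj L Y + conj L X := by
      rw [map_add, map_add]; abel
    rw [e, e', T.hilbert_apply hX hY hZ, T.hilbert_apply hZ' (hT.conj_mem_cartan hY) hX',
      map_add, map_neg, conj_smul, conj_smul, Complex.conj_I]
    module
  have h2 : incl L (rePart L (T.hilbert (incl L P))) = T.hilbert (incl L P) := by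
    rw [incl_rePart, h, ← two_smul ℝ (T.hilbert (incl L P)), smul_smul]
    norm_num
  exact h2

end RealForm

/-! ### The identification of `L` with its dual by the Killing form -/

section Dual

variable (L : Type*) [LieRing L] [LieAlgebra ℝ L]

theorem exists_generalizedInverse {V W : Type*} [AddCommGroup V] [Module ℝ V] [AddCommGroup W]
    [Module ℝ W] (f : V →ₗ[ℝ] W) : ∃ s : W →ₗ[ℝ] V, ∀ v : V, f (s (f v)) = f v := by
  obtain ⟨t, ht⟩ := LinearMap.exists_rightInverse_of_surjective f.rangeRestrict
    (LinearMap.range_rangeRestrict _)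
  obtain ⟨s, hs⟩ := LinearMap.exists_extend t
  refine ⟨s, fun v => ?_⟩
  have h1 := LinearMap.congr_fun hs (f.rangeRestrict v)
  have h2 := LinearMap.congr_fun ht (f.rangeRestrict v)
  have h3 : s (f v) = t (f.rangeRestrict v) := h1
  rw [h3]
  exact congrArg Subtype.val h2

theorem exists_killingSharp : ∃ s : Module.Dual ℝ L →ₗ[ℝ] L,
    ∀ P : L, killingForm ℝ L (s (killingForm ℝ L P)) = killingForm ℝ L P :=
  exists_generalizedInverse (killingForm ℝ L)

/-- The inverse `L^* → L` of the isomorphism `L → L^*`, `P ↦ ⟨P, ·⟩` given by the Killing form (see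
`killingSharp_killingForm` and `killingForm_killingSharp`); a generalized inverse of that map in case
the Killing form is degenerate, which does not occur for a simply connected compact Lie group. -/
def killingSharp : Module.Dual ℝ L →ₗ[ℝ] L := (exists_killingSharp L).choose

theorem killingForm_killingSharp_killingForm (P : L) :
    killingForm ℝ L (killingSharp L (killingForm ℝ L P)) = killingForm ℝ L P :=
  (exists_killingSharp L).choose_spec P

theorem killingSharp_killingForm [LieAlgebra.IsKilling ℝ L] (P : L) :
    killingSharp L (killingForm ℝ L P) = P :=
  LinearMap.ker_eq_bot.1 (LieAlgebra.IsKilling.ker_killingForm_eq_bot ℝ L)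
    (killingForm_killingSharp_killingForm L P)

theorem killingForm_killingSharp [FiniteDimensional ℝ L] [LieAlgebra.IsKilling ℝ L]
    (α : Module.Dual ℝ L) : killingForm ℝ L (killingSharp L α) = α := by
  have hinj : Function.Injective (killingForm ℝ L) :=
    LinearMap.ker_eq_bot.1 (LieAlgebra.IsKilling.ker_killingForm_eq_bot ℝ L)
  obtain ⟨P, rfl⟩ := (LinearMap.injective_iff_surjective_of_finrank_eq_finrank
    (Subspace.dual_finrank_eq (K := ℝ) (V := L)).symm).1 hinj α
  rw [killingSharp_killingForm]

end Dual

/-! ### Bivectors -/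

/-- Elements of `⋀² V` for a finite-dimensional real vector space `V`, as alternating bilinear forms
on the dual space of `V`. -/
abbrev Bivector (V : Type*) [AddCommGroup V] [Module ℝ V] : Type _ :=
  Module.Dual ℝ V [⋀^Fin 2]→ₗ[ℝ] ℝ

/-- The push-forward `f_* : ⋀² V → ⋀² W`, i.e. `(f_* r)(α, β) = r(α ∘ f, β ∘ f)`. -/
def Bivector.pushforward {V W : Type*} [AddCommGroup V] [Module ℝ V] [AddCommGroup W] [Module ℝ W]
    (f : V →ₗ[ℝ] W) (r : Bivector V) : Bivector W :=
  r.compLinearMap f.dualMap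

theorem Bivector.pushforward_apply {V W : Type*} [AddCommGroup V] [Module ℝ V] [AddCommGroup W]
    [Module ℝ W] (f : V →ₗ[ℝ] W) (r : Bivector V) (α β : Module.Dual ℝ W) :
    r.pushforward f ![α, β] = r ![α ∘ₗ f, β ∘ₗ f] := by
  rw [pushforward, AlternatingMap.compLinearMap_apply]
  congr 1
  funext i
  fin_cases i <;> rfl

section Bivector

variable {L : Type*} [LieRing L] [LieAlgebra ℝ L] [FiniteDimensional ℝ L]

/-- `𝓗_L`, viewed as an element of `L ∧ L` by means of the identification of `L` with its dual: the
form with `(⟨P, ·⟩, ⟨Q, ·⟩) ↦ ⟨𝓗_L P, Q⟩`. -/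
def TriangularDecomposition.bivector (T : TriangularDecomposition (ℂ ⊗[ℝ] L)) : Bivector L where
  toFun v := killingForm ℝ L (T.hilbertReal (killingSharp L (v 0))) (killingSharp L (v 1))
  map_update_add' := by
    intro _ v i α β
    fin_cases i <;> simp [Function.update]
  map_update_smul' := by
    intro _ v i c α
    fin_cases i <;> simp [Function.update]
  map_eq_zero_of_eq' v i j h hij := by
    have h01 : v 0 = v 1 := by
      fin_cases i <;> fin_cases j <;> first | exact absurd rfl hij | exact h | exact h.symm
    have h1 := T.hilbertReal_skew (killingSharp L (v 1)) (killingSharp L (v 1))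
    have h2 := LieModule.traceForm_comm ℝ L L (killingSharp L (v 1))
      (T.hilbertReal (killingSharp L (v 1)))
    rw [h01]
    rw [h2] at h1
    linarith

/-- The defining property of `𝓗_L ∈ L ∧ L`. -/
theorem TriangularDecomposition.bivector_killingForm (T : TriangularDecomposition (ℂ ⊗[ℝ] L))
    (P Q : L) : T.bivector ![killingForm ℝ L P, killingForm ℝ L Q] =
      killingForm ℝ L (T.hilbertReal P) Q := by
  have c := LieModule.traceForm_comm ℝ L L
  change killingForm ℝ L (T.hilbertReal (killingSharp L (killingForm ℝ L P)))
    (killingSharp L (killingForm ℝ L Q)) = _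
  rw [c, killingForm_killingSharp_killingForm, c, T.hilbertReal_skew,
    killingForm_killingSharp_killingForm, T.hilbertReal_skew]

end Bivector

/-! ### The Lie group -/

section Group

variable {E : Type*} [NormedAddCommGroup E] [NormedSpace ℝ E] [FiniteDimensional ℝ E]
  {K : Type*} [TopologicalSpace K] [ChartedSpace E K] [Group K]
  [LieGroup 𝓘(ℝ, E) (minSmoothness ℝ 3) K]

instance : FiniteDimensional ℝ (GroupLieAlgebra 𝓘(ℝ, E) K) :=
  inferInstanceAs (FiniteDimensional ℝ E)

/-- The differential at `1` of left translation by `k`. -/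
def leftTranslation (k : K) : GroupLieAlgebra 𝓘(ℝ, E) K →ₗ[ℝ] TangentSpace 𝓘(ℝ, E) k :=
  (mfderiv 𝓘(ℝ, E) 𝓘(ℝ, E) (fun x : K => k * x) 1).toLinearMap

/-- The differential at `1` of right translation by `k`. -/
def rightTranslation (k : K) : GroupLieAlgebra 𝓘(ℝ, E) K →ₗ[ℝ] TangentSpace 𝓘(ℝ, E) k :=
  (mfderiv 𝓘(ℝ, E) 𝓘(ℝ, E) (fun x : K => x * k) 1).toLinearMap

/-- The right trivialization `T_k K → 𝔨` of the tangent bundle: the differential at `k` of right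
translation by `k⁻¹`. -/
def rightTrivialization (k : K) : TangentSpace 𝓘(ℝ, E) k →ₗ[ℝ] GroupLieAlgebra 𝓘(ℝ, E) K :=
  (mfderiv 𝓘(ℝ, E) 𝓘(ℝ, E) (fun x : K => x * k⁻¹) k).toLinearMap

/-- The adjoint representation: `Ad k` is the differential at `1` of `x ↦ k x k⁻¹`. -/
def Ad (k : K) : GroupLieAlgebra 𝓘(ℝ, E) K →ₗ[ℝ] GroupLieAlgebra 𝓘(ℝ, E) K :=
  (mfderiv 𝓘(ℝ, E) 𝓘(ℝ, E) (fun x : K => k * x * k⁻¹) 1).toLinearMap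

/-- The cotangent vector at `k` represented by `(k, P) ∈ K × 𝔨`: its value on `v ∈ T_k K` is the
Killing form of `P` and the right trivialization of `v`. -/
def covector (k : K) (P : GroupLieAlgebra 𝓘(ℝ, E) K) :
    Module.Dual ℝ (TangentSpace 𝓘(ℝ, E) k) :=
  killingForm ℝ (GroupLieAlgebra 𝓘(ℝ, E) K) P ∘ₗ rightTrivialization k

/-- The standard (Lu-Weinstein) Poisson Lie group structure: the bivector field
`π_K|_k = ℓ_{k*} 𝓗 - r_{k*} 𝓗`. -/
def luWeinstein (T : TriangularDecomposition (ℂ ⊗[ℝ] GroupLieAlgebra 𝓘(ℝ, E) K)) (k : K) :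
    Bivector (TangentSpace 𝓘(ℝ, E) k) :=
  T.bivector.pushforward (leftTranslation k) - T.bivector.pushforward (rightTranslation k)

end Group

end LuWeinstein

end

/-! Evaluating a pushed-forward bivector on covectors means pulling the covectors back to the Lie
algebra. Right trivialization inverts `r_k`, so `(k, P)` pulls back along `r_k` to `⟨P, ·⟩`.
Composed with `ℓ_k` it is conjugation by `k`, so the pullback along `ℓ_k` is `⟨P, Ad(k) ·⟩ =
⟨Ad(k⁻¹) P, ·⟩`. The defining property of `𝓗` as a bivector then gives `⟨𝓗 Ad(k⁻¹) P, Ad(k⁻¹) Q⟩ -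
⟨𝓗 P, Q⟩`, and moving the remaining `Ad(k⁻¹)` across the form yields the formula.

Both moves rest on `killingForm_Ad`. Any Lie algebra automorphism preserves the Killing form, so the
substantial point is `Ad_lie`. The bracket is that of left-invariant vector fields; conjugation by
`k` pulls the field of `Ad k X` back to the field of `X` (`mpullback_conj_mulInvariantVectorField`),
and the bracket of vector fields is natural under pullback. -/

namespace LuWeinstein

section LieGroup

open VectorField

variable {E : Type*} [NormedAddCommGroup E] [NormedSpace ℝ E]
  {K : Type*} [TopologicalSpace K] [ChartedSpace E K]

/-- The chain rule at a base point given up to a propositional equality. -/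
theorem mfderiv_comp_base {f g : K → K} {x y : K}
    (hg : MDifferentiableAt 𝓘(ℝ, E) 𝓘(ℝ, E) g y) (hf : MDifferentiableAt 𝓘(ℝ, E) 𝓘(ℝ, E) f x)
    (h : f x = y) :
    mfderiv 𝓘(ℝ, E) 𝓘(ℝ, E) (g ∘ f) x =
      (mfderiv 𝓘(ℝ, E) 𝓘(ℝ, E) g y).comp (mfderiv 𝓘(ℝ, E) 𝓘(ℝ, E) f x) := by
  subst h
  exact mfderiv_comp x hg hf

variable [Group K]

theorem mulInvariantVectorField_at_one (X : GroupLieAlgebra 𝓘(ℝ, E) K) :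
    mulInvariantVectorField X 1 = X := by
  have h : (fun x : K => 1 * x) = id := by ext x; simp
  rw [mulInvariantVectorField, h, mfderiv_id]
  rfl

variable [LieGroup 𝓘(ℝ, E) (minSmoothness ℝ 3) K]

/-! ### Differentials of translations and conjugations. -/

theorem contMDiff_conj (k : K) :
    ContMDiff 𝓘(ℝ, E) 𝓘(ℝ, E) (minSmoothness ℝ 3) (fun x : K => k * x * k⁻¹) :=
  (contMDiff_mul_right (a := k⁻¹)).comp (contMDiff_mul_left (a := k))

theorem minSmoothness_three_ne_zero : minSmoothness ℝ 3 ≠ 0 :=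
  (lt_of_lt_of_le (by simp) le_minSmoothness).ne'

theorem mdifferentiableAt_conj (k x : K) :
    MDifferentiableAt 𝓘(ℝ, E) 𝓘(ℝ, E) (fun x : K => k * x * k⁻¹) x :=
  (contMDiff_conj k).mdifferentiable minSmoothness_three_ne_zero x

theorem mdifferentiableAt_mul_left (k x : K) :
    MDifferentiableAt 𝓘(ℝ, E) 𝓘(ℝ, E) (fun x : K => k * x) x :=
  (contMDiff_mul_left (n := minSmoothness ℝ 3)).mdifferentiable minSmoothness_three_ne_zero x

theorem mdifferentiableAt_mul_right (k x : K) :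
    MDifferentiableAt 𝓘(ℝ, E) 𝓘(ℝ, E) (fun x : K => x * k) x :=
  (contMDiff_mul_right (n := minSmoothness ℝ 3)).mdifferentiable minSmoothness_three_ne_zero x

/-- Chain rule for two mutually inverse conjugations. Tying `x` and `y` by an equation lets both
base points be `1`, although `k⁻¹ * 1 * k⁻¹⁻¹` is not definitionally `1`; the identity lives on `E`
because every tangent space is `E` by definition. -/
theorem mfderiv_conj_comp_inv {k x y : K} (h : k⁻¹ * x * k⁻¹⁻¹ = y) :
    (mfderiv 𝓘(ℝ, E) 𝓘(ℝ, E) (fun x : K => k * x * k⁻¹) y).comp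
      (mfderiv 𝓘(ℝ, E) 𝓘(ℝ, E) (fun x : K => k⁻¹ * x * k⁻¹⁻¹) x) =
      ContinuousLinearMap.id ℝ E := by
  have e := mfderiv_comp_base (mdifferentiableAt_conj (E := E) k y)
    (mdifferentiableAt_conj k⁻¹ x) h
  have h' : (fun x : K => k * x * k⁻¹) ∘ (fun x : K => k⁻¹ * x * k⁻¹⁻¹) = id := by
    ext x; simp [mul_assoc]
  rw [h', mfderiv_id] at e
  exact e.symm

theorem mfderiv_conj_inv_comp {k x y : K} (h : k * x * k⁻¹ = y) :
    (mfderiv 𝓘(ℝ, E) 𝓘(ℝ, E) (fun x : K => k⁻¹ * x * k⁻¹⁻¹) y).comp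
      (mfderiv 𝓘(ℝ, E) 𝓘(ℝ, E) (fun x : K => k * x * k⁻¹) x) =
      ContinuousLinearMap.id ℝ E := by
  have e := mfderiv_comp_base (mdifferentiableAt_conj (E := E) k⁻¹ y)
    (mdifferentiableAt_conj k x) h
  have h' : (fun x : K => k⁻¹ * x * k⁻¹⁻¹) ∘ (fun x : K => k * x * k⁻¹) = id := by
    ext x; simp [mul_assoc]
  rw [h', mfderiv_id] at e
  exact e.symm

/-- Needed because `mpullback` is expressed through `ContinuousLinearMap.inverse`, which is only
meaningful once a two-sided inverse has been exhibited. -/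
theorem inverse_mfderiv_conj (k x : K) :
    (mfderiv 𝓘(ℝ, E) 𝓘(ℝ, E) (fun x : K => k * x * k⁻¹) x).inverse =
      mfderiv 𝓘(ℝ, E) 𝓘(ℝ, E) (fun x : K => k⁻¹ * x * k⁻¹⁻¹) (k * x * k⁻¹) :=
  ContinuousLinearMap.inverse_eq (mfderiv_conj_comp_inv (by simp [mul_assoc]))
    (mfderiv_conj_inv_comp rfl)

/-- Conjugation intertwines the left translations by `g` and `k g k⁻¹`. -/
theorem mfderiv_conj_comp_mul_left (k g : K) :
    (mfderiv 𝓘(ℝ, E) 𝓘(ℝ, E) (fun x : K => k * x * k⁻¹) g).comp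
      (mfderiv 𝓘(ℝ, E) 𝓘(ℝ, E) (fun x : K => g * x) 1) =
    (mfderiv 𝓘(ℝ, E) 𝓘(ℝ, E) (fun x : K => k * g * k⁻¹ * x) 1).comp
      (mfderiv 𝓘(ℝ, E) 𝓘(ℝ, E) (fun x : K => k * x * k⁻¹) 1) := by
  have e := mfderiv_comp_base (mdifferentiableAt_conj (E := E) k g)
    (mdifferentiableAt_mul_left g 1) (mul_one g)
  have e' := mfderiv_comp_base (mdifferentiableAt_mul_left (E := E) (k * g * k⁻¹) 1)
    (mdifferentiableAt_conj k 1) (by simp)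
  have h : (fun x : K => k * x * k⁻¹) ∘ (fun x : K => g * x) =
      (fun x : K => k * g * k⁻¹ * x) ∘ (fun x : K => k * x * k⁻¹) := by
    ext x; simp [mul_assoc]
  rw [h] at e
  exact e.symm.trans e'

/-- The pullback by conjugation with `k` of the left-invariant vector field of `Ad k X` is that
of `X`. -/
theorem mpullback_conj_mulInvariantVectorField (k : K) (X : GroupLieAlgebra 𝓘(ℝ, E) K) :
    mpullback 𝓘(ℝ, E) 𝓘(ℝ, E) (fun x : K => k * x * k⁻¹) (mulInvariantVectorField (Ad k X)) =
      mulInvariantVectorField X := by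
  ext g
  have e := DFunLike.congr_fun (mfderiv_conj_comp_mul_left (E := E) k g) X
  have e' := DFunLike.congr_fun (mfderiv_conj_inv_comp (E := E) (k := k) (x := g) rfl)
    (mulInvariantVectorField X g)
  rw [mpullback_apply, inverse_mfderiv_conj]
  -- By `e`, the field of `Ad k X` at `k g k⁻¹` is the image under conjugation of the field of `X`
  -- at `g`; `e'` then cancels the two conjugations.
  exact (congrArg (mfderiv 𝓘(ℝ, E) 𝓘(ℝ, E) (fun x : K => k⁻¹ * x * k⁻¹⁻¹) (k * g * k⁻¹))
    e.symm).trans e'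

/-! ### `Ad k` and the two translations in the right trivialization. -/

theorem Ad_inv_Ad (k : K) (X : GroupLieAlgebra 𝓘(ℝ, E) K) : Ad k⁻¹ (Ad k X) = X :=
  DFunLike.congr_fun (mfderiv_conj_inv_comp (E := E) (k := k) (x := 1) (by simp)) X

theorem Ad_Ad_inv (k : K) (X : GroupLieAlgebra 𝓘(ℝ, E) K) : Ad k (Ad k⁻¹ X) = X :=
  DFunLike.congr_fun (mfderiv_conj_comp_inv (E := E) (k := k) (x := 1) (by simp)) X

/-- Left translation by `k` followed by right translation by `k⁻¹` is conjugation by `k`: this is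
where `Ad` enters the formula. -/
theorem rightTrivialization_leftTranslation (k : K) :
    rightTrivialization k ∘ₗ leftTranslation k = (Ad k : GroupLieAlgebra 𝓘(ℝ, E) K →ₗ[ℝ] _) := by
  have e := mfderiv_comp_base (mdifferentiableAt_mul_right (E := E) k⁻¹ k)
    (mdifferentiableAt_mul_left k 1) (mul_one k)
  exact congrArg ContinuousLinearMap.toLinearMap e.symm

theorem rightTrivialization_rightTranslation (k : K) :
    rightTrivialization k ∘ₗ rightTranslation k =
      (LinearMap.id : GroupLieAlgebra 𝓘(ℝ, E) K →ₗ[ℝ] _) := by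
  have e := mfderiv_comp_base (mdifferentiableAt_mul_right (E := E) k⁻¹ k)
    (mdifferentiableAt_mul_right k 1) (one_mul k)
  have h : (fun x : K => x * k⁻¹) ∘ (fun x : K => x * k) = id := by ext x; simp
  rw [h, mfderiv_id] at e
  exact congrArg ContinuousLinearMap.toLinearMap e.symm

/-! ### Invariance of the bracket and the Killing form; pullbacks of covectors. -/

variable [FiniteDimensional ℝ E]

/-- `Ad k` is a homomorphism of Lie algebras. -/
theorem Ad_lie (k : K) (X Y : GroupLieAlgebra 𝓘(ℝ, E) K) : Ad k ⁅X, Y⁆ = ⁅Ad k X, Ad k Y⁆ := by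
  have e := mpullback_mlieBracket (I := 𝓘(ℝ, E)) (I' := 𝓘(ℝ, E)) (n := minSmoothness ℝ 3)
    (f := fun x : K => k * x * k⁻¹) (x₀ := 1)
    (mdifferentiableAt_mulInvariantVectorField (Ad k X))
    (mdifferentiableAt_mulInvariantVectorField (Ad k Y))
    (contMDiff_conj k).contMDiffAt (minSmoothness_monotone (by norm_cast))
  -- Writing `⁅Ad k X, Ad k Y⁆` as `Ad k` of a vector makes the pullback formula apply to the
  -- left-hand side as well; at `1`, `e` becomes `Ad k⁻¹ ⁅Ad k X, Ad k Y⁆ = ⁅X, Y⁆`.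
  rw [mpullback_conj_mulInvariantVectorField, mpullback_conj_mulInvariantVectorField,
    ← GroupLieAlgebra.bracket_def, ← mulInvariantVector_mlieBracket,
    ← GroupLieAlgebra.bracket_def, ← Ad_Ad_inv k ⁅Ad k X, Ad k Y⁆,
    mpullback_conj_mulInvariantVectorField, mulInvariantVectorField_at_one] at e
  rw [← e, Ad_Ad_inv]

/-- `Ad k` as an automorphism of the Lie algebra. -/
noncomputable def AdEquiv (k : K) : GroupLieAlgebra 𝓘(ℝ, E) K ≃ₗ⁅ℝ⁆ GroupLieAlgebra 𝓘(ℝ, E) K where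
  __ := Ad k
  map_lie' := Ad_lie k _ _
  invFun := Ad k⁻¹
  left_inv := Ad_inv_Ad k
  right_inv := Ad_Ad_inv k

/-- Automorphisms preserve the Killing form; with `X = Ad k (Ad k⁻¹ X)` this says that `Ad k⁻¹` is
the adjoint of `Ad k`. -/
theorem killingForm_Ad (k : K) (X Y : GroupLieAlgebra 𝓘(ℝ, E) K) :
    killingForm ℝ (GroupLieAlgebra 𝓘(ℝ, E) K) X (Ad k Y) =
      killingForm ℝ (GroupLieAlgebra 𝓘(ℝ, E) K) (Ad k⁻¹ X) Y := by
  conv_lhs => rw [← Ad_Ad_inv k X]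
  exact LieAlgebra.killingForm_of_equiv_apply (AdEquiv k) (Ad k⁻¹ X) Y

theorem covector_comp_leftTranslation (k : K) (P : GroupLieAlgebra 𝓘(ℝ, E) K) :
    covector k P ∘ₗ leftTranslation k =
      killingForm ℝ (GroupLieAlgebra 𝓘(ℝ, E) K) (Ad k⁻¹ P) := by
  rw [covector, LinearMap.comp_assoc, rightTrivialization_leftTranslation]
  ext X
  exact killingForm_Ad k P X

theorem covector_comp_rightTranslation (k : K) (P : GroupLieAlgebra 𝓘(ℝ, E) K) :
    covector k P ∘ₗ rightTranslation k = killingForm ℝ (GroupLieAlgebra 𝓘(ℝ, E) K) P := by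
  rw [covector, LinearMap.comp_assoc, rightTrivialization_rightTranslation, LinearMap.comp_id]

end LieGroup

end LuWeinstein

theorem mainTheorem10 {E : Type*} [NormedAddCommGroup E] [NormedSpace ℝ E] [FiniteDimensional ℝ E]
    {K : Type*} [TopologicalSpace K] [ChartedSpace E K] [Group K]
    [LieGroup 𝓘(ℝ, E) (minSmoothness ℝ 3) K]
    [CompactSpace K] [ConnectedSpace K] [SimplyConnectedSpace K]
    (T : LuWeinstein.TriangularDecomposition (ℂ ⊗[ℝ] GroupLieAlgebra 𝓘(ℝ, E) K))
    (hT : T.IsCompatible) (k : K) (P Q : GroupLieAlgebra 𝓘(ℝ, E) K) :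
    LuWeinstein.luWeinstein T k ![LuWeinstein.covector k P, LuWeinstein.covector k Q] =
      killingForm ℝ (GroupLieAlgebra 𝓘(ℝ, E) K)
        ((LuWeinstein.Ad k ∘ₗ T.hilbertReal ∘ₗ LuWeinstein.Ad k⁻¹ - T.hilbertReal) P) Q := by
  rw [LuWeinstein.luWeinstein, AlternatingMap.sub_apply, LuWeinstein.Bivector.pushforward_apply,
    LuWeinstein.Bivector.pushforward_apply, LuWeinstein.covector_comp_leftTranslation,
    LuWeinstein.covector_comp_leftTranslation, LuWeinstein.covector_comp_rightTranslation,
    LuWeinstein.covector_comp_rightTranslation, T.bivector_killingForm, T.bivector_killingForm,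
    LinearMap.sub_apply, map_sub, LinearMap.sub_apply]
  -- The right-translation terms agree. What remains is `⟨𝓗 Ad(k⁻¹) P, Ad(k⁻¹) Q⟩ = ⟨Ad(k) 𝓗 Ad(k⁻¹)
  -- P, Q⟩`, which is invariance for `k⁻¹`.
  congr 1
  have h := LuWeinstein.killingForm_Ad k⁻¹ (T.hilbertReal (LuWeinstein.Ad k⁻¹ P)) Q
  rwa [inv_inv] at h
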